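/- Let $G$ be a (finite-dimensional, real) Lie group with Lie algebra $\mathfrak g=T_eG$, let $H\subset G$ be a closed subgroup, let $G/H$ carry its usual smooth structure, let $\pi:G\to G/H$ be the projection and $o=H\in G/H$ the base point. Let $\tilde a$ be a smooth Riemannian metric and $\tilde X$ a smooth vector field on $G/H$, both invariant under the action of $G$. Let $b_0$ be a real number and let $\varphi$ be a positive $C^\infty$ function on $(-b_0,b_0)$ such that $$\varphi(s)-s\varphi'(s)+(b^2-s^2)\varphi''(s)>0\qquad\text{whenever } |s|\le b<b_0,$$ and suppose that $\sqrt{\tilde a(\tilde X(x),\tilde X(x))}<b_0$ for all $x\in G/H$. Let $F$ be the invariant $(\alpha,\beta)$-metric $$F(x,y)=\alpha(x,y)\,\varphi\!\left(\frac{\tilde a(\tilde X(x),y)}{\alpha(x,y)}\right),\qquad \alpha(x,y)=\sqrt{\tilde a_x(y,y)}.$$ (Here $F(x,0)=0$.) A vector $X\in\mathfrak g$ is called a geodesic vector of $F$ (respectively of $\tilde a$) if $X\neq 0$ and the curve $t\mapsto \exp(tX)\cdot o$ is a geodesic of $(G/H,F)$ (respectively of $(G/H,\tilde a)$), where a geodesic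 of a Finsler metric is a smooth curve that satisfies the Euler–Lagrange equations of the energy $\tfrac12F^2$ (for $\tilde a$, of $\tfrac12\alpha^2$). Theorem. Let $X\in\mathfrak g$ be a vector with $d\pi_e(X)=\tilde X(o)$; for example, if $\mathfrak g=\mathfrak m\oplus\mathfrak h$ is a reductive decomposition and $T_o(G/H)$ is identified with $\mathfrak m$ through $d\pi_e$, the vector $X=\tilde X(H)\in\mathfrak m$. Then $X$ is a geodesic vector of $F$ if and only if it is a geodesic vector of $\tilde a$. -/

import Mathlib

open scoped Manifold ContDiff

noncomputable section

namespace HomogeneousFinsler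

section Geodesics

variable {E : Type*} [NormedAddCommGroup E] [NormedSpace ℝ E]
  {M : Type*} [TopologicalSpace M] [ChartedSpace E M] [IsManifold 𝓘(ℝ, E) ∞ M]

/-- The energy Lagrangian `L = F² / 2` of a function `F` on the tangent bundle, written in the
preferred chart `ψ` at `x₀`: `L (u, v) = F (ψ⁻¹ u, d(ψ⁻¹)_u v)² / 2`, where `u` are the
coordinates of the point and `v` are the components of the tangent vector. -/
def localEnergy (F : (x : M) → TangentSpace 𝓘(ℝ, E) x → ℝ) (x₀ : M) (u v : E) : ℝ :=
  (F ((extChartAt 𝓘(ℝ, E) x₀).symm u)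
    (mfderiv 𝓘(ℝ, E) 𝓘(ℝ, E) (extChartAt 𝓘(ℝ, E) x₀).symm u v)) ^ 2 / 2

/-- A smooth curve `γ : ℝ → M` is a (constant speed) geodesic of the Finsler metric `F` if it
satisfies the Euler-Lagrange equation `d/dt (∂L/∂v) = ∂L/∂u` of the energy `L = F² / 2` at every
time `t₀`, written in the chart at `γ t₀`. As the Hessian of `F² / 2` along the fibres is positive
definite for a Finsler metric, this is the equation `ẍⁱ + 2 Gⁱ(x, ẋ) = 0` of the geodesic spray
(for non-constant `γ`); for a Riemannian norm `F` it is `∇_γ' γ' = 0`. -/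
def IsGeodesic (F : (x : M) → TangentSpace 𝓘(ℝ, E) x → ℝ) (γ : ℝ → M) : Prop :=
  ContMDiff 𝓘(ℝ, ℝ) 𝓘(ℝ, E) ∞ γ ∧
  ∀ t₀ : ℝ,
    let x : ℝ → E := fun t => extChartAt 𝓘(ℝ, E) (γ t₀) (γ t)
    let L : E → E → ℝ := localEnergy F (γ t₀)
    HasDerivAt (fun t => fderiv ℝ (fun v => L (x t) v) (deriv x t))
      (fderiv ℝ (fun u => L u (deriv x t₀)) (x t₀)) t₀

/-- The Finsler function `α(x, y) = √(a_x(y, y))` of a smooth Riemannian metric `a`. -/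
def riemannianNorm
    (a : Bundle.ContMDiffRiemannianMetric 𝓘(ℝ, E) ∞ E (fun x : M => TangentSpace 𝓘(ℝ, E) x))
    (x : M) (y : TangentSpace 𝓘(ℝ, E) x) : ℝ :=
  √(a.inner x y y)

/-- The function `F = α φ(β / α)`, where `α` is the norm of `a` and `β = a(X, ·)`. -/
def alphaBeta
    (a : Bundle.ContMDiffRiemannianMetric 𝓘(ℝ, E) ∞ E (fun x : M => TangentSpace 𝓘(ℝ, E) x))
    (X : (x : M) → TangentSpace 𝓘(ℝ, E) x) (φ : ℝ → ℝ)
    (x : M) (y : TangentSpace 𝓘(ℝ, E) x) : ℝ :=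
  riemannianNorm a x y * φ (a.inner x (X x) y / riemannianNorm a x y)

/-- The conditions on `(a, X, φ)` under which `F = α φ(β / α)` is called an `(α,β)`-metric:
`φ` is positive and smooth on `(-b₀, b₀)`,
`φ(s) - s φ'(s) + (b² - s²) φ''(s) > 0` whenever `|s| ≤ b < b₀`, and `‖X‖ < b₀` everywhere.
They imply that `F` is a Finsler metric. -/
structure IsAlphaBetaData
    (a : Bundle.ContMDiffRiemannianMetric 𝓘(ℝ, E) ∞ E (fun x : M => TangentSpace 𝓘(ℝ, E) x))
    (X : (x : M) → TangentSpace 𝓘(ℝ, E) x) (φ : ℝ → ℝ) (b₀ : ℝ) : Prop where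
  contDiffOn : ContDiffOn ℝ ∞ φ (Set.Ioo (-b₀) b₀)
  pos : ∀ s ∈ Set.Ioo (-b₀) b₀, 0 < φ s
  convex : ∀ s b : ℝ, |s| ≤ b → b < b₀ →
    0 < φ s - s * deriv φ s + (b ^ 2 - s ^ 2) * deriv (deriv φ) s
  norm_lt : ∀ x : M, riemannianNorm a x (X x) < b₀

end Geodesics

section HomogeneousSpaces

variable {EG : Type*} [NormedAddCommGroup EG] [NormedSpace ℝ EG]
  {G : Type*} [TopologicalSpace G] [ChartedSpace EG G] [Group G]
  {E : Type*} [NormedAddCommGroup E] [NormedSpace ℝ E]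

/-- The atlas on `G ⧸ H` is the one that makes `G ⧸ H` a homogeneous manifold: the projection
`π : G → G ⧸ H` is smooth and has smooth local sections around every point. For a closed subgroup
`H` of a Lie group `G` there is exactly one smooth structure on `G ⧸ H` with these properties. -/
structure IsHomogeneousManifold (H : Subgroup G) [ChartedSpace E (G ⧸ H)] : Prop where
  contMDiff_mk : ContMDiff 𝓘(ℝ, EG) 𝓘(ℝ, E) ∞ (QuotientGroup.mk : G → G ⧸ H)
  exists_section : ∀ x : G ⧸ H, ∃ (U : Set (G ⧸ H)) (σ : G ⧸ H → G), IsOpen U ∧ x ∈ U ∧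
    ContMDiffOn 𝓘(ℝ, E) 𝓘(ℝ, EG) ∞ σ U ∧ ∀ y ∈ U, (QuotientGroup.mk (σ y) : G ⧸ H) = y

/-- The Riemannian metric `a` on `G ⧸ H` is invariant under all translations
`τ_g : x ↦ g • x`. -/
def IsInvariantMetric {H : Subgroup G} [ChartedSpace E (G ⧸ H)]
    [IsManifold 𝓘(ℝ, E) ∞ (G ⧸ H)]
    (a : Bundle.ContMDiffRiemannianMetric 𝓘(ℝ, E) ∞ E
      (fun x : G ⧸ H => TangentSpace 𝓘(ℝ, E) x)) : Prop :=
  ∀ (g : G) (x : G ⧸ H) (u v : TangentSpace 𝓘(ℝ, E) x),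
    a.inner (g • x)
      (mfderiv 𝓘(ℝ, E) 𝓘(ℝ, E) (fun z : G ⧸ H => g • z) x u)
      (mfderiv 𝓘(ℝ, E) 𝓘(ℝ, E) (fun z : G ⧸ H => g • z) x v) = a.inner x u v

/-- The vector field `X` on `G ⧸ H` is invariant under all translations: `dτ_g (X x) = X (g • x)`. -/
def IsInvariantField {H : Subgroup G} [ChartedSpace E (G ⧸ H)]
    (X : (x : G ⧸ H) → TangentSpace 𝓘(ℝ, E) x) : Prop :=
  ∀ (g : G) (x : G ⧸ H),
    mfderiv 𝓘(ℝ, E) 𝓘(ℝ, E) (fun z : G ⧸ H => g • z) x (X x) = X (g • x)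

/-- `c` is the curve `t ↦ exp (t X)` in the Lie group `G`: the integral curve through `1` of the
left-invariant vector field with value `X` at `1`. -/
def IsExpCurve (X : GroupLieAlgebra 𝓘(ℝ, EG) G) (c : ℝ → G) : Prop :=
  c 0 = 1 ∧ IsMIntegralCurve c (mulInvariantVectorField X : (g : G) → TangentSpace 𝓘(ℝ, EG) g)

/-- A vector `X` of the Lie algebra of `G` is a geodesic vector of the Finsler metric `F` on
`G ⧸ H` if `X ≠ 0` and `t ↦ exp (t X) • o` is a geodesic of `F`, where `o = H` is the base
point. -/
def IsGeodesicVector {H : Subgroup G} [ChartedSpace E (G ⧸ H)]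
    (F : (x : G ⧸ H) → TangentSpace 𝓘(ℝ, E) x → ℝ) (X : GroupLieAlgebra 𝓘(ℝ, EG) G) : Prop :=
  X ≠ 0 ∧ ∃ c : ℝ → G, IsExpCurve X c ∧
    IsGeodesic F (fun t => c t • (QuotientGroup.mk (1 : G) : G ⧸ H))

end HomogeneousSpaces

end HomogeneousFinsler

end

open scoped Manifold ContDiff Topology

namespace HomogeneousFinsler

/-! By invariance `|X̃|` is a constant `b`, and `t ↦ exp (t X) • o` is an integral curve of `X̃`. So
only the first derivatives of the energies at the vectors `X̃(x)` enter the Euler-Lagrange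
equations. Put `A = α²`. Then `A - 2β + b² = |y - X̃|²` is nonnegative and vanishes at `y = X̃(x)`,
so there `dA = 2 dβ`, in the fibre and in the base directions alike. With `A = β = b²` this makes
`d(β/√A) = 0`: the terms in `φ'` drop out and `d(F²/2) = φ(b)² d(α²/2)`. Along the curve the two
Euler-Lagrange equations thus differ by the nonzero constant factor `φ(b)²`. If `b = 0`, then `X̃ =
0` and `F = φ(0) α`. The two differentials are `fderiv_localEnergy_fiber` and
`fderiv_localEnergy_base`; `isGeodesic_alphaBeta_iff` combines them. -/

/-- If `A = β = b²` and `dA = 2 dβ` at `z`, then the differential at `z` of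
`(√A φ(β / √A))² / 2` is `φ(b)² dβ`. -/
theorem hasFDerivAt_alphaBeta_energy {V : Type*} [NormedAddCommGroup V] [NormedSpace ℝ V]
    {A β : V → ℝ} {β' : V →L[ℝ] ℝ} {z : V} {b : ℝ} {φ : ℝ → ℝ}
    (hA : HasFDerivAt A ((2 : ℝ) • β') z) (hβ : HasFDerivAt β β' z)
    (hAz : A z = b ^ 2) (hβz : β z = b ^ 2) (hb : 0 < b) (hφ : DifferentiableAt ℝ φ b) :
    HasFDerivAt (fun y => (√(A y) * φ (β y / √(A y))) ^ 2 / 2) (φ b ^ 2 • β') z := by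
  have hs : √(A z) = b := by rw [hAz, Real.sqrt_sq hb.le]
  have hsqrt := hA.sqrt (by rw [hAz]; positivity)
  have hquot : β z / √(A z) = b := by rw [hs, hβz]; field_simp
  have hdiv := hβ.mul ((hasDerivAt_inv (by rw [hs]; exact hb.ne')).comp_hasFDerivAt z hsqrt)
  have hφ' : HasDerivAt φ (deriv φ b) ((β * (Inv.inv ∘ fun y => √(A y))) z) := by
    have : (β * (Inv.inv ∘ fun y => √(A y))) z = b := hquot
    simpa only [this] using hφ.hasDerivAt
  have h := (((hsqrt.mul (hφ'.comp_hasFDerivAt z hdiv)).pow 2).mul_const (1 / 2 : ℝ))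
  refine (h.congr_of_eventuallyEq (.of_forall fun y => ?_)).congr_fderiv ?_
  · simp [div_eq_mul_inv]
  · ext v
    simp only [Function.comp_apply, Pi.mul_apply, ← div_eq_mul_inv, hs, hβz, smul_apply,
      add_apply, smul_eq_mul, nsmul_eq_mul]
    push_cast
    -- Both `d√A` and `dβ / b` equal `β' / b`, so the coefficient of `deriv φ b` is `1/b - b²/b³ =
    -- 0`.
    field_simp
    ring

theorem hasFDerivAt_bilin_comp_self {V W : Type*} [NormedAddCommGroup V] [NormedSpace ℝ V]
    [NormedAddCommGroup W] [NormedSpace ℝ W] (B : W →L[ℝ] W →L[ℝ] ℝ)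
    (hB : ∀ u v, B u v = B v u) (D : V →L[ℝ] W) (w : V) :
    HasFDerivAt (fun v => B (D v) (D v)) ((2 : ℝ) • (B (D w)).comp D) w := by
  refine (B.hasFDerivAt_of_bilinear D.hasFDerivAt D.hasFDerivAt).congr_fderiv ?_
  ext v
  simp [hB (D v) (D w)]
  ring

/-! ### Energies in a chart, along integral curves of a field of constant norm. -/

section Curves

variable {E : Type*} [NormedAddCommGroup E] [NormedSpace ℝ E]
  {M : Type*} [TopologicalSpace M] [ChartedSpace E M] [IsManifold 𝓘(ℝ, E) ∞ M]
  {a : Bundle.ContMDiffRiemannianMetric 𝓘(ℝ, E) ∞ E (fun x : M => TangentSpace 𝓘(ℝ, E) x)}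
  {X : (x : M) → TangentSpace 𝓘(ℝ, E) x}

theorem inner_self_nonneg (x : M) (v : TangentSpace 𝓘(ℝ, E) x) : 0 ≤ a.inner x v v := by
  by_cases hv : v = 0
  · simp [hv]
  · exact (a.pos x v hv).le

/-- The differential at `u` of the inverse of the chart at `x₀`. -/
noncomputable def chartFrame (x₀ : M) (u : E) :
    E →L[ℝ] TangentSpace 𝓘(ℝ, E) ((extChartAt 𝓘(ℝ, E) x₀).symm u) :=
  mfderiv 𝓘(ℝ, E) 𝓘(ℝ, E) (extChartAt 𝓘(ℝ, E) x₀).symm u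

/-- The coordinate field with constant components `v` in the chart at `x₀` is smooth. -/
theorem contMDiffAt_coordinateField (x₀ : M) (v : E) {u : E}
    (hu : u ∈ (extChartAt 𝓘(ℝ, E) x₀).target) :
    ContMDiffAt 𝓘(ℝ, E) 𝓘(ℝ, E).tangent 1
      (fun u : E => (⟨(extChartAt 𝓘(ℝ, E) x₀).symm u,
        chartFrame x₀ u v⟩ : TangentBundle 𝓘(ℝ, E) M)) u := by
  have hopen := isOpen_extChartAt_target (I := 𝓘(ℝ, E)) x₀
  have h1 : ContMDiffOn 𝓘(ℝ, E) 𝓘(ℝ, E) 2 (extChartAt 𝓘(ℝ, E) x₀).symm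
      (extChartAt 𝓘(ℝ, E) x₀).target :=
    (contMDiffOn_extChartAt_symm (n := ∞) x₀).of_le (by norm_cast)
  have : IsManifold 𝓘(ℝ, E) 1 M := IsManifold.of_le (n := ∞) (by norm_cast)
  have h2 := h1.contMDiffOn_tangentMapWithin (m := 1) (by norm_num) hopen.uniqueMDiffOn
  have h3 : ContMDiff 𝓘(ℝ, E) 𝓘(ℝ, E).tangent 1
      (fun u : E => (⟨u, v⟩ : TangentBundle 𝓘(ℝ, E) E)) := by
    intro u
    exact contMDiffAt_vectorSpace_iff_contDiffAt.2 contDiffAt_const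
  have h4 := (h2.comp (s := (extChartAt 𝓘(ℝ, E) x₀).target) h3.contMDiffOn
    (fun u hu => hu)).contMDiffAt (hopen.mem_nhds hu)
  refine h4.congr_of_eventuallyEq ?_
  filter_upwards [hopen.mem_nhds hu] with y hy
  simp only [Function.comp_apply, tangentMapWithin, chartFrame]
  rw [mfderivWithin_of_mem_nhds (hopen.mem_nhds hy)]
  rfl

theorem differentiableAt_inner {p : E → M} {Y Z : (u : E) → TangentSpace 𝓘(ℝ, E) (p u)} {u : E}
    (hY : ContMDiffAt 𝓘(ℝ, E) 𝓘(ℝ, E).tangent 1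
      (fun u : E => (⟨p u, Y u⟩ : TangentBundle 𝓘(ℝ, E) M)) u)
    (hZ : ContMDiffAt 𝓘(ℝ, E) 𝓘(ℝ, E).tangent 1
      (fun u : E => (⟨p u, Z u⟩ : TangentBundle 𝓘(ℝ, E) M)) u) :
    DifferentiableAt ℝ (fun u => a.inner (p u) (Y u) (Z u)) u := by
  have : IsManifold 𝓘(ℝ, E) 1 M := IsManifold.of_le (n := ∞) (by norm_cast)
  have hp : ContMDiffAt 𝓘(ℝ, E) 𝓘(ℝ, E) 1 p u := (Bundle.contMDiffAt_totalSpace.1 hY).1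
  have h : ContMDiffAt 𝓘(ℝ, E) (𝓘(ℝ, E).prod 𝓘(ℝ)) 1
      (fun m ↦ Bundle.TotalSpace.mk' ℝ (E := Bundle.Trivial M ℝ) (p m)
        (a.inner (p m) (Y m) (Z m))) u :=
    ContMDiffAt.clm_bundle_apply₂ (F₁ := E) (F₂ := E)
      (((a.contMDiff.of_le (by norm_cast)).contMDiffAt).comp u hp) hY hZ
  rw [Bundle.contMDiffAt_totalSpace] at h
  exact (contMDiffAt_iff_contDiffAt.1 h.2).differentiableAt one_ne_zero

theorem mdifferentiableAt_extChartAt_symm (x₀ : M) {u : E}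
    (hu : u ∈ (extChartAt 𝓘(ℝ, E) x₀).target) :
    MDifferentiableAt 𝓘(ℝ, E) 𝓘(ℝ, E) (extChartAt 𝓘(ℝ, E) x₀).symm u := by
  have : IsManifold 𝓘(ℝ, E) 1 M := IsManifold.of_le (n := ∞) (by norm_cast)
  exact (mdifferentiableOn_extChartAt_symm (I := 𝓘(ℝ, E)) u hu).mdifferentiableAt
    ((isOpen_extChartAt_target x₀).mem_nhds hu)

/-- The coordinates of the velocity of an integral curve are those of the vector field. -/
theorem chartFrame_deriv {γ : ℝ → M} (hγ : IsMIntegralCurve γ X) (x₀ : M) {t : ℝ}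
    (ht : γ t ∈ (extChartAt 𝓘(ℝ, E) x₀).source) :
    chartFrame x₀ (extChartAt 𝓘(ℝ, E) x₀ (γ t))
        (deriv (fun t => extChartAt 𝓘(ℝ, E) x₀ (γ t)) t) =
      X ((extChartAt 𝓘(ℝ, E) x₀).symm (extChartAt 𝓘(ℝ, E) x₀ (γ t))) := by
  have : IsManifold 𝓘(ℝ, E) 1 M := IsManifold.of_le (n := ∞) (by norm_cast)
  have hx : MDifferentiableAt 𝓘(ℝ, ℝ) 𝓘(ℝ, E) (fun t => extChartAt 𝓘(ℝ, E) x₀ (γ t)) t :=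
    (mdifferentiableAt_extChartAt (by simpa using ht)).comp t (hγ t).mdifferentiableAt
  have hx' := hx.differentiableAt.hasDerivAt.hasFDerivAt.hasMFDerivAt
  have hD := (mdifferentiableAt_extChartAt_symm x₀
    ((extChartAt 𝓘(ℝ, E) x₀).map_source ht)).hasMFDerivAt
  have h := hD.comp t hx'
  have hev : γ =ᶠ[𝓝 t]
      (extChartAt 𝓘(ℝ, E) x₀).symm ∘ fun t => extChartAt 𝓘(ℝ, E) x₀ (γ t) := by
    filter_upwards [(hγ t).continuousAt.preimage_mem_nhds
      ((isOpen_extChartAt_source x₀).mem_nhds ht)] with s hs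
    exact ((extChartAt 𝓘(ℝ, E) x₀).left_inv hs).symm
  have hu := hasMFDerivAt_unique (h.congr_of_eventuallyEq hev) (hγ t)
  have h1 := congrArg (fun l : ℝ →L[ℝ] E => l 1) hu
  rw [(extChartAt 𝓘(ℝ, E) x₀).left_inv ht]
  have h2 : chartFrame x₀ (extChartAt 𝓘(ℝ, E) x₀ (γ t))
      ((1 : ℝ) • deriv (fun t => extChartAt 𝓘(ℝ, E) x₀ (γ t)) t) = (1 : ℝ) • X (γ t) := h1
  rwa [one_smul, one_smul] at h2

/-- The differential of the energy of `α φ(β / α)` along the fibres, at the vector field `X`. -/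
theorem fderiv_localEnergy_fiber {φ : ℝ → ℝ} {b : ℝ} (hb : 0 < b)
    (hnorm : ∀ x, a.inner x (X x) (X x) = b ^ 2) (hφ : DifferentiableAt ℝ φ b) (x₀ : M) {u w : E}
    (hw : chartFrame x₀ u w = X ((extChartAt 𝓘(ℝ, E) x₀).symm u)) :
    fderiv ℝ (fun v => localEnergy (alphaBeta a X φ) x₀ u v) w = φ b ^ 2 •
      (a.inner _ (X ((extChartAt 𝓘(ℝ, E) x₀).symm u))).comp (chartFrame x₀ u) := by
  have hA : HasFDerivAt (fun v : E => a.inner _ (chartFrame x₀ u v) (chartFrame x₀ u v))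
      ((2 : ℝ) • (a.inner _ (chartFrame x₀ u w)).comp (chartFrame x₀ u)) w :=
    hasFDerivAt_bilin_comp_self (V := E) (W := E) (a.inner ((extChartAt 𝓘(ℝ, E) x₀).symm u))
      (a.symm _) (chartFrame x₀ u) w
  rw [hw] at hA
  refine (hasFDerivAt_alphaBeta_energy hA (ContinuousLinearMap.hasFDerivAt _) ?_ ?_ hb hφ).fderiv
  · rw [hw, hnorm]
  · rw [ContinuousLinearMap.comp_apply, hw, hnorm]

/-- The differential of the energy of `α φ(β / α)` in the direction of the base, at the vector
field `X`. -/
theorem fderiv_localEnergy_base {φ : ℝ → ℝ} {b : ℝ} (hb : 0 < b)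
    (hX : ContMDiff 𝓘(ℝ, E) 𝓘(ℝ, E).tangent ∞
      (fun x => (⟨x, X x⟩ : TangentBundle 𝓘(ℝ, E) M)))
    (hnorm : ∀ x, a.inner x (X x) (X x) = b ^ 2) (hφ : DifferentiableAt ℝ φ b) (x₀ : M) {u w : E}
    (hu : u ∈ (extChartAt 𝓘(ℝ, E) x₀).target)
    (hw : chartFrame x₀ u w = X ((extChartAt 𝓘(ℝ, E) x₀).symm u)) :
    fderiv ℝ (fun u => localEnergy (alphaBeta a X φ) x₀ u w) u = φ b ^ 2 •
      fderiv ℝ (fun u => a.inner _ (X ((extChartAt 𝓘(ℝ, E) x₀).symm u)) (chartFrame x₀ u w)) u := by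
  have hD := contMDiffAt_coordinateField x₀ w hu
  have hXp := ((hX.of_le (m := 1) (by norm_cast)).contMDiffAt
    (x := (extChartAt 𝓘(ℝ, E) x₀).symm u)).comp u
    (((contMDiffOn_extChartAt_symm (n := ∞) x₀).of_le (m := 1) (by norm_cast)).contMDiffAt
      ((isOpen_extChartAt_target (I := 𝓘(ℝ, E)) x₀).mem_nhds hu))
  have hA := differentiableAt_inner (a := a) hD hD
  have hβ := differentiableAt_inner (a := a) hXp hD
  -- With the components `w` fixed, `A - 2β = |w - X|² - b² ≥ -b²`, with equality at `u`. Minimality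
  -- gives `dA = 2 dβ` without differentiating the metric or the field.
  have hmin : IsLocalMin ((fun u => a.inner _ (chartFrame x₀ u w) (chartFrame x₀ u w)) -
      fun u => 2 * a.inner _ (X ((extChartAt 𝓘(ℝ, E) x₀).symm u)) (chartFrame x₀ u w)) u := by
    refine .of_forall fun y => ?_
    have h := inner_self_nonneg (a := a) _ (chartFrame x₀ y w - X _)
    have hs := a.symm _ (chartFrame x₀ y w) (X _)
    simp only [map_sub, sub_apply, hs, hnorm] at h
    simp only [Pi.sub_apply]
    rw [hw, hnorm]
    linarith
  have hsub := hmin.hasFDerivAt_eq_zero (hA.hasFDerivAt.sub (hβ.hasFDerivAt.const_mul 2))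
  have hA' := hA.hasFDerivAt
  rw [sub_eq_zero.1 hsub] at hA'
  refine (hasFDerivAt_alphaBeta_energy hA' hβ.hasFDerivAt ?_ ?_ hb hφ).fderiv
  · rw [hw, hnorm]
  · rw [hw, hnorm]

/-- This lets the formulas for the energy of `F` serve for `α` too, as the case `φ = 1`. -/
theorem riemannianNorm_eq_alphaBeta_one : riemannianNorm a = alphaBeta a X fun _ => 1 := by
  funext x y
  simp [alphaBeta]

theorem isGeodesic_alphaBeta_iff {φ : ℝ → ℝ} {b : ℝ} (hb : 0 ≤ b)
    (hX : ContMDiff 𝓘(ℝ, E) 𝓘(ℝ, E).tangent ∞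
      (fun x => (⟨x, X x⟩ : TangentBundle 𝓘(ℝ, E) M)))
    (hnorm : ∀ x, a.inner x (X x) (X x) = b ^ 2) (hφ : DifferentiableAt ℝ φ b) (hφb : φ b ≠ 0)
    {γ : ℝ → M} (hγ : IsMIntegralCurve γ X) :
    IsGeodesic (alphaBeta a X φ) γ ↔ IsGeodesic (riemannianNorm a) γ := by
  refine and_congr_right fun _ => forall_congr' fun t₀ => ?_
  have hsrc : ∀ᶠ t in 𝓝 t₀, γ t ∈ (extChartAt 𝓘(ℝ, E) (γ t₀)).source :=
    (hγ t₀).continuousAt.preimage_mem_nhds (extChartAt_source_mem_nhds _)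
  have hk : φ b ^ 2 ≠ 0 := pow_ne_zero 2 hφb
  -- The fibre identity is needed for all `t` near `t₀`, as it is differentiated in `t`; the base
  -- identity only at `t₀`. The velocity is a separate variable `w`, so that `chartFrame_deriv` can
  -- be restated in terms of it.
  suffices h : (∀ᶠ t in 𝓝 t₀, ∀ w, w = deriv (fun t => extChartAt 𝓘(ℝ, E) (γ t₀) (γ t)) t →
      fderiv ℝ (fun v => localEnergy (alphaBeta a X φ) (γ t₀)
        (extChartAt 𝓘(ℝ, E) (γ t₀) (γ t)) v) w = φ b ^ 2 •
      fderiv ℝ (fun v => localEnergy (riemannianNorm a) (γ t₀)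
        (extChartAt 𝓘(ℝ, E) (γ t₀) (γ t)) v) w) ∧
      ∀ w, w = deriv (fun t => extChartAt 𝓘(ℝ, E) (γ t₀) (γ t)) t₀ →
      fderiv ℝ (fun u => localEnergy (alphaBeta a X φ) (γ t₀) u w)
        (extChartAt 𝓘(ℝ, E) (γ t₀) (γ t₀)) = φ b ^ 2 •
      fderiv ℝ (fun u => localEnergy (riemannianNorm a) (γ t₀) u w)
        (extChartAt 𝓘(ℝ, E) (γ t₀) (γ t₀)) by
    dsimp only
    rw [h.2 _ rfl, Filter.EventuallyEq.hasDerivAt_iff (h.1.mono fun t ht => ht _ rfl)]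
    refine ⟨fun H => ?_, fun H => H.const_smul (φ b ^ 2)⟩
    have H' := H.const_smul (φ b ^ 2)⁻¹
    simpa only [inv_smul_smul₀ hk, Pi.smul_def] using H'
  rcases hb.eq_or_lt with rfl | hb
  -- Here `√A` need not be differentiable at the zero velocity, so the energies themselves are
  -- compared.
  · have hX0 : ∀ x, X x = 0 := fun x => by
      by_contra hx
      exact (a.pos x _ hx).ne' (by simpa using hnorm x)
    have hL : ∀ u v, localEnergy (alphaBeta a X φ) (γ t₀) u v =
        φ 0 ^ 2 • localEnergy (riemannianNorm a) (γ t₀) u v := fun u v => by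
      simp only [localEnergy, alphaBeta, hX0, map_zero, zero_apply, zero_div, smul_eq_mul]
      ring
    simp only [hL]
    have hsmul : ∀ (k : ℝ) (f : E → ℝ) (z : E),
        fderiv ℝ (fun y => k • f y) z = k • fderiv ℝ f z :=
      fun k f z => congrFun (fderiv_const_smul_field k) z
    exact ⟨.of_forall fun t w _ => hsmul _ _ _, fun w _ => hsmul _ _ _⟩
  · rw [riemannianNorm_eq_alphaBeta_one (X := X)]
    have h1 : DifferentiableAt ℝ (fun _ : ℝ => (1 : ℝ)) b := differentiableAt_const _
    constructor
    · filter_upwards [hsrc] with t ht w hw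
      have hw' := chartFrame_deriv hγ (γ t₀) ht
      rw [← hw] at hw'
      rw [fderiv_localEnergy_fiber hb hnorm hφ _ hw', fderiv_localEnergy_fiber hb hnorm h1 _ hw',
        one_pow, one_smul]
    · intro w hw
      have ht := hsrc.self_of_nhds
      have hw' := chartFrame_deriv hγ (γ t₀) ht
      rw [← hw] at hw'
      have hu := (extChartAt 𝓘(ℝ, E) (γ t₀)).map_source ht
      rw [fderiv_localEnergy_base hb hX hnorm hφ _ hu hw',
        fderiv_localEnergy_base hb hX hnorm h1 _ hu hw', one_pow, one_smul]

end Curves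

/-! ### Orbits of one-parameter subgroups on `G ⧸ H`. -/

section HomogeneousSpaces

variable {EG : Type*} [NormedAddCommGroup EG] [NormedSpace ℝ EG]
  {G : Type*} [TopologicalSpace G] [ChartedSpace EG G] [Group G] [LieGroup 𝓘(ℝ, EG) ∞ G]
  {E : Type*} [NormedAddCommGroup E] [NormedSpace ℝ E]
  {H : Subgroup G} [ChartedSpace E (G ⧸ H)]

/-- Near `x` the translation is `π ∘ L_g ∘ σ` for a smooth local section `σ`. -/
theorem IsHomogeneousManifold.mdifferentiable_smul
    (hGH : IsHomogeneousManifold (EG := EG) (E := E) H) (g : G) :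
    MDifferentiable 𝓘(ℝ, E) 𝓘(ℝ, E) (fun z : G ⧸ H => g • z) := by
  intro x
  obtain ⟨U, σ, hU, hx, hσ, hsec⟩ := hGH.exists_section x
  have h : ContMDiffAt 𝓘(ℝ, E) 𝓘(ℝ, E) ∞ (fun z => (QuotientGroup.mk (g * σ z) : G ⧸ H)) x :=
    (hGH.contMDiff_mk.contMDiffAt).comp x
      ((contMDiff_mul_left (I := 𝓘(ℝ, EG)) (n := ∞) (a := g)).contMDiffAt.comp x
        (hσ.contMDiffAt (hU.mem_nhds hx)))
  refine (h.mdifferentiableAt (by simp)).congr_of_eventuallyEq ?_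
  filter_upwards [hU.mem_nhds hx] with y hy
  nth_rw 1 [← hsec y hy]
  rfl

/-- The orbit of the base point under `exp (t X)` is an integral curve of every invariant vector
field with value `dπ X` at the base point. -/
theorem IsExpCurve.isMIntegralCurve_smul_mk
    (hGH : IsHomogeneousManifold (EG := EG) (E := E) H)
    {Xfield : (x : G ⧸ H) → TangentSpace 𝓘(ℝ, E) x} (hXinv : IsInvariantField Xfield)
    {X : GroupLieAlgebra 𝓘(ℝ, EG) G}
    (hX : mfderiv 𝓘(ℝ, EG) 𝓘(ℝ, E) (QuotientGroup.mk : G → G ⧸ H) 1 X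
      = Xfield (QuotientGroup.mk (1 : G)))
    {c : ℝ → G} (hc : IsExpCurve X c) :
    IsMIntegralCurve (fun t => c t • (QuotientGroup.mk (1 : G) : G ⧸ H)) Xfield := by
  intro t
  have hmk := hGH.contMDiff_mk.mdifferentiable (by simp)
  have hL : MDifferentiable 𝓘(ℝ, EG) 𝓘(ℝ, EG) (fun g => c t * g) :=
    (contMDiff_mul_left (I := 𝓘(ℝ, EG)) (n := ∞) (a := c t)).mdifferentiable (by simp)
  have hcurve : (fun t => c t • (QuotientGroup.mk (1 : G) : G ⧸ H)) =
      (QuotientGroup.mk : G → G ⧸ H) ∘ c := by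
    funext s
    exact congrArg QuotientGroup.mk (mul_one (c s))
  have hder := (hmk (c t)).hasMFDerivAt.comp t (hc.2 t)
  refine (hder.congr_of_eventuallyEq (.of_eq hcurve)).congr_mfderiv ?_
  -- Differentiating `π ∘ L_{c t} = τ_{c t} ∘ π` at `1` turns the velocity into `dτ_{c t} (dπ X)`.
  -- The point `g` is a variable because `c t * 1` and `c t` index different tangent spaces.
  have h1 : ∀ g, c t * 1 = g → mfderiv 𝓘(ℝ, EG) 𝓘(ℝ, E) (QuotientGroup.mk : G → G ⧸ H) g
      (mfderiv 𝓘(ℝ, EG) 𝓘(ℝ, EG) (fun g => c t * g) 1 X) =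
      mfderiv 𝓘(ℝ, EG) 𝓘(ℝ, E) (fun g => (QuotientGroup.mk (c t * g) : G ⧸ H)) 1 X := by
    rintro _ rfl
    exact congrArg (fun l : EG →L[ℝ] E => l X) (mfderiv_comp (1 : G) (hmk (c t * 1)) (hL 1)).symm
  have h2 : mfderiv 𝓘(ℝ, EG) 𝓘(ℝ, E) (fun g => (QuotientGroup.mk (c t * g) : G ⧸ H)) 1 X =
      mfderiv 𝓘(ℝ, E) 𝓘(ℝ, E) (fun z : G ⧸ H => c t • z) (QuotientGroup.mk 1)
        (mfderiv 𝓘(ℝ, EG) 𝓘(ℝ, E) (QuotientGroup.mk : G → G ⧸ H) 1 X) :=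
    congrArg (fun l : EG →L[ℝ] E => l X)
      (mfderiv_comp (1 : G) (hGH.mdifferentiable_smul (c t) (QuotientGroup.mk 1)) (hmk 1))
  have h3 := (h1 _ (mul_one _)).trans (h2.trans
    ((congrArg _ hX).trans (hXinv (c t) (QuotientGroup.mk 1))))
  ext
  change mfderiv 𝓘(ℝ, EG) 𝓘(ℝ, E) (QuotientGroup.mk : G → G ⧸ H) (c t)
    ((1 : ℝ) • mulInvariantVectorField X (c t)) = (1 : ℝ) • Xfield (c t • QuotientGroup.mk 1)
  rw [one_smul, one_smul]
  exact h3

end HomogeneousSpaces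

end HomogeneousFinsler

/-! ### The main theorem. -/

theorem mainTheorem1
    {EG : Type*} [NormedAddCommGroup EG] [NormedSpace ℝ EG] [FiniteDimensional ℝ EG]
    {G : Type*} [TopologicalSpace G] [T2Space G] [ChartedSpace EG G] [Group G]
    [LieGroup 𝓘(ℝ, EG) ∞ G]
    (H : Subgroup G) (hH : IsClosed (H : Set G))
    {E : Type*} [NormedAddCommGroup E] [NormedSpace ℝ E] [FiniteDimensional ℝ E]
    [ChartedSpace E (G ⧸ H)] [IsManifold 𝓘(ℝ, E) ∞ (G ⧸ H)]
    (hGH : HomogeneousFinsler.IsHomogeneousManifold (EG := EG) (E := E) H)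
    (a : Bundle.ContMDiffRiemannianMetric 𝓘(ℝ, E) ∞ E
      (fun x : G ⧸ H => TangentSpace 𝓘(ℝ, E) x))
    (ha : HomogeneousFinsler.IsInvariantMetric a)
    (Xfield : (x : G ⧸ H) → TangentSpace 𝓘(ℝ, E) x)
    (hXsmooth : ContMDiff 𝓘(ℝ, E) 𝓘(ℝ, E).tangent ∞
      (fun x => (⟨x, Xfield x⟩ : TangentBundle 𝓘(ℝ, E) (G ⧸ H))))
    (hXinv : HomogeneousFinsler.IsInvariantField Xfield)
    (φ : ℝ → ℝ) (b₀ : ℝ)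
    (hφ : HomogeneousFinsler.IsAlphaBetaData a Xfield φ b₀)
    (X : GroupLieAlgebra 𝓘(ℝ, EG) G)
    (hX : mfderiv 𝓘(ℝ, EG) 𝓘(ℝ, E) (QuotientGroup.mk : G → G ⧸ H) 1 X
      = Xfield (QuotientGroup.mk (1 : G))) :
    HomogeneousFinsler.IsGeodesicVector (HomogeneousFinsler.alphaBeta a Xfield φ) X ↔
      HomogeneousFinsler.IsGeodesicVector (HomogeneousFinsler.riemannianNorm a) X := by
  have hnonneg := HomogeneousFinsler.inner_self_nonneg (a := a) _
    (Xfield (QuotientGroup.mk (1 : G)))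
  set b := HomogeneousFinsler.riemannianNorm a _ (Xfield (QuotientGroup.mk (1 : G))) with hb_def
  -- `G` acts transitively and preserves both the metric and the field.
  have hnorm : ∀ x, a.inner x (Xfield x) (Xfield x) = b ^ 2 := fun x => by
    obtain ⟨g, rfl⟩ := QuotientGroup.mk_surjective x
    have h := ha g (QuotientGroup.mk 1) (Xfield _) (Xfield _)
    rw [hXinv g, show g • (QuotientGroup.mk (1 : G) : G ⧸ H) = QuotientGroup.mk g from
      congrArg QuotientGroup.mk (mul_one g)] at h
    rw [hb_def, HomogeneousFinsler.riemannianNorm, Real.sq_sqrt hnonneg, h]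
  have hb : 0 ≤ b := Real.sqrt_nonneg _
  have hlt : b < b₀ := hφ.norm_lt (QuotientGroup.mk 1)
  have hmem : b ∈ Set.Ioo (-b₀) b₀ := ⟨by linarith, hlt⟩
  have hdiff := (hφ.contDiffOn.contDiffAt (isOpen_Ioo.mem_nhds hmem)).differentiableAt (by simp)
  exact and_congr_right fun _ => exists_congr fun c => and_congr_right fun hc =>
    HomogeneousFinsler.isGeodesic_alphaBeta_iff hb hXsmooth hnorm hdiff (hφ.pos _ hmem).ne'
      (hc.isMIntegralCurve_smul_mk hGH hXinv hX)
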